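/- All graphs are finite, simple and non-empty, and $\log$ is the natural logarithm. A graph $H$ is a *minor* of a graph $G$ if a graph isomorphic to $H$ can be obtained from $G$ by vertex deletions, edge deletions and edge contractions. The *Hadwiger number* $\eta(G)$ is the maximum integer $t$ such that the complete graph $K_t$ is a minor of $G$. For a graph $H$, let $f(H)$ be the infimum (in $[-\infty,\infty]$) of all real numbers $d$ such that every graph with average degree at least $d$ contains $H$ as a minor. Below, $o(1)$ denotes a function of $t$ alone that tends to $0$ as $t\to\infty$. **Theorem.** There is a constant $c>0$ such that $f(K_t)\le (c+o(1))\,t\sqrt{\log t}$ for every integer $t\ge 1$. Moreover, for every such constant $c$ there is a function $\varepsilon:\mathbb{N}\to\mathbb{R}$ with $\varepsilon(t)\to 0$ as $t\to\infty$ such that the following holds: for every integer $t\ge 1$ and every graph $G$, if $$\eta(G)\ \ge\ (2c+\varepsilon(t))\,t\sqrt{\log t},$$ then $G$ contains a bipartite subgraph $\hat G\subseteq G$ with $\eta(\hat G)\ge t$. -/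

import Mathlib

/-- `H` is a minor of `G`: there are pairwise disjoint, connected (in particular non-empty)
sets of vertices of `G`, one for each vertex of `H`, such that `G` has an edge between any two
of these sets that belong to adjacent vertices of `H`. Deleting all other vertices and edges and
contracting each of the sets to one vertex leaves a copy of `H`. -/
def IsGraphMinor {W : Type*} {V : Type*} (H : SimpleGraph W) (G : SimpleGraph V) : Prop :=
  ∃ B : W → Set V,
    (∀ w, (G.induce (B w)).Connected) ∧
    (∀ w w', w ≠ w' → Disjoint (B w) (B w')) ∧
    (∀ w w', H.Adj w w' → ∃ x ∈ B w, ∃ y ∈ B w', G.Adj x y)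

/-- The Hadwiger number: the largest `t` such that the complete graph on `t` vertices is a minor
of `G`. For a finite graph the maximum exists, see `isGreatest_hadwigerNumber`. -/
noncomputable def hadwigerNumber {V : Type*} (G : SimpleGraph V) : ℕ :=
  sSup {t : ℕ | IsGraphMinor (SimpleGraph.completeGraph (Fin t)) G}

theorem isGreatest_hadwigerNumber {V : Type*} [Finite V] (G : SimpleGraph V) :
    IsGreatest {t : ℕ | IsGraphMinor (SimpleGraph.completeGraph (Fin t)) G} (hadwigerNumber G) := by
  have hne : {t : ℕ | IsGraphMinor (SimpleGraph.completeGraph (Fin t)) G}.Nonempty :=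
    ⟨0, fun _ => ∅, fun w => w.elim0, fun w => w.elim0, fun w => w.elim0⟩
  have hbdd : BddAbove {t : ℕ | IsGraphMinor (SimpleGraph.completeGraph (Fin t)) G} := by
    refine ⟨Nat.card V, ?_⟩
    rintro t ⟨B, hc, hd, -⟩
    choose f hf using fun w => Set.nonempty_coe_sort.mp (hc w).nonempty
    have hinj : Function.Injective f := by
      intro w w' h
      by_contra hw
      exact Set.disjoint_left.mp (hd w w' hw) (hf w) (h ▸ hf w')
    simpa using Nat.card_le_card_of_injective f hinj
  exact ⟨Nat.sSup_mem hne hbdd, fun t ht => le_csSup hbdd ht⟩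

open Classical in
/-- The average of the degrees of the vertices of a finite non-empty graph. -/
noncomputable def averageDegree {V : Type*} [Fintype V] (G : SimpleGraph V) : ℝ :=
  (∑ v, (G.degree v : ℝ)) / Fintype.card V

/-- The extremal function for `H` minors: the infimum of all real numbers `d` such that every
(finite, non-empty) graph with average degree at least `d` contains `H` as a minor. The infimum is
taken in the extended reals, so it would be `⊤` if there were no such `d`, and it is `⊥` for the
graph with one vertex, where every `d` qualifies. -/
noncomputable def extremalFunction {W : Type*} (H : SimpleGraph W) : EReal :=
  sInf {x : EReal | ∃ d : ℝ, x = (d : EReal) ∧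
    ∀ (V : Type) [Fintype V] [Nonempty V] (G : SimpleGraph V),
      d ≤ averageDegree G → IsGraphMinor H G}

/-- `c` is a positive constant with `f(K_t) ≤ (c + o(1)) t √(log t)` for every integer `t ≥ 1`,
where `f` is the extremal function for minors and `o(1)` tends to `0` as `t → ∞`. -/
def IsKostochkaThomasonConstant (c : ℝ) : Prop :=
  0 < c ∧ ∃ ε : ℕ → ℝ, Filter.Tendsto ε Filter.atTop (nhds 0) ∧
    ∀ t : ℕ, 1 ≤ t →
      extremalFunction (SimpleGraph.completeGraph (Fin t)) ≤
        (((c + ε t) * (t * Real.sqrt (Real.log t)) : ℝ) : EReal)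

/-! Bipartite part: take `h = η(G)` branch sets of a complete minor and 2-colour each along a
spanning tree. Swapping the two colours on a branch set keeps its tree bichromatic but toggles
whether a chosen edge to another branch set is bichromatic. Averaging over all swaps, half of the
chosen edges can be kept, so a bipartite subgraph has a minor `F` on `h` vertices with average
degree at least `(h - 1) / 2` (`IsGraphMinor.exists_bichromatic`). Once this exceeds `f(K_t)`, `F`
has a `K_t` minor.

Existence of `c`: contraction turns large average degree into a minor whose minimum degree is at
least half its order (`exists_minor_minDegree`). That minor, or a large nearly complete part of it,
has short connections robust under deletions (`exists_minor_robustlyLinked`). A random set of `s ≈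
√(log t)` vertices there has neighbours outside a `q ^ s` proportion of vertices, so it misses an
earlier branch set of the same kind with probability about `q ^ (s ^ 2)`, which is less than `1 /
t`. Hence `t` branch sets of size `O(s)` can be chosen greedily
(`SimpleGraph.RobustlyLinked.isGraphMinor`). -/

theorem SimpleGraph.connected_induce_iff_closed {V : Type*} {G : SimpleGraph V} {s : Set V} :
    (G.induce s).Connected ↔ ∃ u ∈ s, ∀ P : V → Prop, P u →
      (∀ x ∈ s, ∀ y ∈ s, G.Adj x y → P x → P y) → ∀ x ∈ s, P x := by
  rw [SimpleGraph.connected_iff_exists_forall_reachable]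
  constructor
  · rintro ⟨⟨u, hu⟩, h⟩
    refine ⟨u, hu, fun P hP hcl x hx => ?_⟩
    have hr : ∀ z, (G.induce s).Reachable ⟨u, hu⟩ z → P z := fun z hz => by
      rw [SimpleGraph.reachable_iff_reflTransGen] at hz
      induction hz with
      | refl => exact hP
      | tail _ hbc ih => exact hcl _ (Subtype.coe_prop _) _ (Subtype.coe_prop _) hbc ih
    exact hr _ (h ⟨x, hx⟩)
  · rintro ⟨u, hu, h⟩
    refine ⟨⟨u, hu⟩, fun ⟨x, hx⟩ => ?_⟩
    obtain ⟨hx', hr⟩ := h (fun x => ∃ hx : x ∈ s, (G.induce s).Reachable ⟨u, hu⟩ ⟨x, hx⟩)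
      ⟨hu, SimpleGraph.Reachable.refl _⟩ (fun x hx y hy hxy ⟨_, hr⟩ =>
        ⟨hy, hr.trans (SimpleGraph.Adj.reachable (by simpa using hxy))⟩) x hx
    exact hr

/-- Adjacency is symmetric, so the negation of a closed predicate is closed too; hence any vertex
can serve as the root. -/
theorem SimpleGraph.Connected.forall_of_closed {V : Type*} {G : SimpleGraph V} {s : Set V}
    (h : (G.induce s).Connected) {P : V → Prop}
    (hcl : ∀ x ∈ s, ∀ y ∈ s, G.Adj x y → P x → P y) {u : V} (hu : u ∈ s) (hPu : P u) :
    ∀ x ∈ s, P x := by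
  obtain ⟨r, hr, hr'⟩ := SimpleGraph.connected_induce_iff_closed.1 h
  have hrP : P r := by
    by_contra hn
    exact hr' (fun x => ¬ P x) hn
      (fun x hx y hy hxy hnx hy' => hnx (hcl y hy x hx hxy.symm hy')) u hu hPu
  exact hr' P hrP hcl

theorem IsGraphMinor.trans {U V W : Type*} {K : SimpleGraph U} {H : SimpleGraph W}
    {G : SimpleGraph V} (hKH : IsGraphMinor K H) (hHG : IsGraphMinor H G) : IsGraphMinor K G := by
  obtain ⟨C, hCc, hCd, hCa⟩ := hKH
  obtain ⟨B, hBc, hBd, hBa⟩ := hHG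
  refine ⟨fun k => ⋃ h ∈ C k, B h, fun k => ?_, fun k k' hk => ?_, fun k k' hk => ?_⟩
  · rw [SimpleGraph.connected_induce_iff_closed]
    obtain ⟨w, hw, hcl⟩ := SimpleGraph.connected_induce_iff_closed.1 (hCc k)
    obtain ⟨⟨u, hu⟩⟩ := (hBc w).nonempty
    refine ⟨u, Set.mem_biUnion hw hu, fun P hP hPcl => ?_⟩
    have key : ∀ h ∈ C k, ∀ z ∈ B h, P z → ∀ x ∈ B h, P x := fun h hh z hz hPz =>
      (hBc h).forall_of_closed (fun x hx y hy => hPcl x (Set.mem_biUnion hh hx) y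
        (Set.mem_biUnion hh hy)) hz hPz
    have := hcl (fun h => ∀ x ∈ B h, P x) (key w hw u hu hP) (fun h hh h' hh' hadj hQ => by
      obtain ⟨x, hx, y, hy, hxy⟩ := hBa h h' hadj
      exact key h' hh' y hy (hPcl x (Set.mem_biUnion hh hx) y (Set.mem_biUnion hh' hy) hxy
        (hQ x hx)))
    intro x hx
    obtain ⟨h, hh, hxh⟩ := Set.mem_iUnion₂.1 hx
    exact this h hh x hxh
  · simp only [Set.disjoint_iUnion_left, Set.disjoint_iUnion_right]
    intro h hh h' hh'
    refine hBd _ _ ?_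
    rintro rfl
    exact Set.disjoint_left.1 (hCd k k' hk) (by assumption) (by assumption)
  · obtain ⟨h, hh, h', hh', hadj⟩ := hCa k k' hk
    obtain ⟨x, hx, y, hy, hxy⟩ := hBa h h' hadj
    exact ⟨x, Set.mem_biUnion hh hx, y, Set.mem_biUnion hh' hy, hxy⟩

theorem SimpleGraph.induce_singleton_connected {V : Type*} (G : SimpleGraph V) (v : V) :
    (G.induce {v}).Connected := by
  rw [SimpleGraph.connected_induce_iff_closed]
  exact ⟨v, rfl, fun P hP _ x hx => by rwa [Set.mem_singleton_iff.1 hx]⟩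

theorem IsGraphMinor.of_injective {V W : Type*} {H : SimpleGraph W} {G : SimpleGraph V}
    (f : W → V) (hf : Function.Injective f) (hadj : ∀ x y, H.Adj x y → G.Adj (f x) (f y)) :
    IsGraphMinor H G :=
  ⟨fun w => {f w}, fun w => G.induce_singleton_connected _,
    fun w w' h => by simpa using fun h' => h (hf h'), fun w w' h => ⟨_, rfl, _, rfl, hadj _ _ h⟩⟩

theorem IsGraphMinor.induce {V : Type*} (G : SimpleGraph V) (s : Set V) :
    IsGraphMinor (G.induce s) G :=
  .of_injective (↑) Subtype.val_injective fun _ _ h => h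

theorem IsGraphMinor.of_le {V : Type*} {H G : SimpleGraph V} (h : H ≤ G) : IsGraphMinor H G :=
  .of_injective id Function.injective_id fun _ _ h' => h h'

/-- The graph on the same vertices in which `v` is made isolated and its neighbours are joined
to `u`. -/
def SimpleGraph.mergeInto {V : Type*} (G : SimpleGraph V) (u v : V) : SimpleGraph V where
  Adj x y := x ≠ y ∧ x ≠ v ∧ y ≠ v ∧ (G.Adj x y ∨ (x = u ∧ G.Adj v y) ∨ (y = u ∧ G.Adj v x))
  symm := ⟨by
    rintro x y ⟨h1, h2, h3, h4⟩
    refine ⟨h1.symm, h3, h2, ?_⟩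
    rcases h4 with h | h | h
    · exact Or.inl h.symm
    · exact Or.inr (Or.inr h)
    · exact Or.inr (Or.inl h)⟩
  loopless := ⟨fun x h => h.1 rfl⟩

theorem IsGraphMinor.mergeInto {V : Type*} {G : SimpleGraph V} {u v : V} (huv : G.Adj u v) :
    IsGraphMinor ((G.mergeInto u v).induce {v}ᶜ) G := by
  classical
  refine ⟨fun w => {x | x = w ∨ ((w : V) = u ∧ x = v)}, fun w => ?_, fun w w' h => ?_, ?_⟩
  · rw [SimpleGraph.connected_induce_iff_closed]
    refine ⟨w, Or.inl rfl, fun P hP hcl x hx => ?_⟩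
    rcases hx with rfl | ⟨h1, rfl⟩
    · exact hP
    · exact hcl w (Or.inl rfl) _ (Or.inr ⟨h1, rfl⟩) (h1 ▸ huv) hP
  · rw [Set.disjoint_left]
    rintro x (h1 | ⟨h1, h1'⟩) (h2 | ⟨h2, h2'⟩)
    · exact h (Subtype.ext (h1.symm.trans h2))
    · exact w.2 (h1.symm.trans h2')
    · exact w'.2 (h2.symm.trans h1')
    · exact h (Subtype.ext (h1.trans h2.symm))
  · rintro ⟨w, hw⟩ ⟨w', hw'⟩ ⟨-, -, -, h | ⟨h, h'⟩ | ⟨h, h'⟩⟩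
    · exact ⟨w, Or.inl rfl, w', Or.inl rfl, h⟩
    · exact ⟨v, Or.inr ⟨h, rfl⟩, w', Or.inl rfl, h'⟩
    · exact ⟨w, Or.inl rfl, v, Or.inr ⟨h, rfl⟩, h'.symm⟩

/-! ### Contracting to a small minor of large minimum degree -/

open Classical in
theorem SimpleGraph.exists_le_card_edgeFinset_eq {V : Type*} [Fintype V] (G : SimpleGraph V)
    {k : ℕ} (hk : k ≤ G.edgeFinset.card) : ∃ H ≤ G, H.edgeFinset.card = k := by
  obtain ⟨s, hs, hsk⟩ := Finset.exists_subset_card_eq hk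
  have hsG : (s : Set (Sym2 V)) ⊆ G.edgeSet := fun e he => by simpa using hs he
  obtain ⟨H, hH⟩ : ∃ H : SimpleGraph V, H.edgeSet = s := by
    refine ⟨SimpleGraph.fromEdgeSet s, ?_⟩
    rw [SimpleGraph.edgeSet_fromEdgeSet, sdiff_eq_left, Set.disjoint_left]
    intro e he hd
    exact G.not_isDiag_of_mem_edgeSet (hsG he) hd
  refine ⟨H, ?_, ?_⟩
  · rw [← SimpleGraph.edgeSet_subset_edgeSet, hH]
    exact hsG
  · rw [← hsk]
    congr 1
    ext e
    exact Set.mem_toFinset.trans (Set.ext_iff.1 hH e)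

open Classical in
-- Contracting `uv` loses only that edge and one edge for each triangle on it: edges away from `v`
-- survive, and the other edges at `v` become new edges at `u`.
theorem SimpleGraph.card_edgeFinset_le_mergeInto {V : Type*} [Fintype V] (G : SimpleGraph V)
    {u v : V} (huv : G.Adj u v) :
    G.edgeFinset.card ≤ ((G.mergeInto u v).induce {v}ᶜ).edgeFinset.card + 1 +
      (G.neighborFinset u ∩ G.neighborFinset v).card := by
  have hsupp : (G.mergeInto u v).support ⊆ {v}ᶜ := by
    rintro x ⟨y, hy⟩
    exact hy.2.1
  have h1 : ((G.mergeInto u v).induce {v}ᶜ).edgeFinset.card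
      = (G.mergeInto u v).edgeFinset.card := by
    convert SimpleGraph.card_edgeFinset_induce_of_support_subset hsupp
  have hnew : ((G.neighborFinset v \ G.neighborFinset u).erase u).image (fun w => s(u, w))
      ⊆ (G.mergeInto u v).edgeFinset := by
    intro e he
    obtain ⟨w, hw, rfl⟩ := Finset.mem_image.1 he
    simp only [Finset.mem_erase, Finset.mem_sdiff, SimpleGraph.mem_neighborFinset] at hw
    rw [SimpleGraph.mem_edgeFinset, SimpleGraph.mem_edgeSet]
    exact ⟨hw.1.symm, huv.ne, hw.2.1.ne', Or.inr (Or.inl ⟨rfl, hw.2.1⟩)⟩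
  have hold : (G.deleteIncidenceSet v).edgeFinset ⊆ (G.mergeInto u v).edgeFinset := by
    intro e
    induction e using Sym2.ind with
    | _ x y =>
      simp only [SimpleGraph.mem_edgeFinset, SimpleGraph.mem_edgeSet,
        SimpleGraph.deleteIncidenceSet_adj]
      rintro ⟨h, hx, hy⟩
      exact ⟨h.ne, hx, hy, Or.inl h⟩
  have hdisj : Disjoint (G.deleteIncidenceSet v).edgeFinset
      (((G.neighborFinset v \ G.neighborFinset u).erase u).image (fun w => s(u, w))) := by
    rw [Finset.disjoint_right]
    intro e he
    obtain ⟨w, hw, rfl⟩ := Finset.mem_image.1 he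
    simp only [Finset.mem_erase, Finset.mem_sdiff, SimpleGraph.mem_neighborFinset] at hw
    simp only [SimpleGraph.mem_edgeFinset, SimpleGraph.mem_edgeSet,
        SimpleGraph.deleteIncidenceSet_adj]
    exact fun h => hw.2.2 h.1
  have hcard := Finset.card_le_card (Finset.union_subset hold hnew)
  rw [Finset.card_union_of_disjoint hdisj, Finset.card_image_of_injective _
    (fun a b h => Sym2.congr_right.1 h), Finset.card_erase_of_mem
    (by simpa using huv.symm)] at hcard
  have h2 := Finset.card_sdiff_add_card_inter (G.neighborFinset v) (G.neighborFinset u)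
  rw [Finset.inter_comm, SimpleGraph.card_neighborFinset_eq_degree] at h2
  have h3 := G.card_edgeFinset_deleteIncidenceSet v
  have h4 : (G.deleteIncidenceSet v).edgeFinset.card = G.edgeFinset.card - G.degree v := by
    convert h3
  omega

open Classical in
/-- A graph with at least `d` times as many edges as vertices has a minor with at most `2 d`
vertices and minimum degree at least `d`. -/
theorem exists_minor_minDegree {d : ℕ} (hd : 1 ≤ d) : ∀ (n : ℕ) (V : Type) [Fintype V]
    [Nonempty V] (G : SimpleGraph V), Fintype.card V = n → d * n ≤ G.edgeFinset.card →
    ∃ (W : Type) (_ : Fintype W) (H : SimpleGraph W), Nonempty W ∧ IsGraphMinor H G ∧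
      Fintype.card W ≤ 2 * d ∧ ∀ w, d ≤ H.degree w := by
  intro n
  induction n with
  | zero =>
    intro V _ _ G hn
    exact absurd hn Fintype.card_ne_zero
  | succ n ih =>
    intro V _ _ G₀ hn hE
    -- With exactly `d * (n + 1)` edges the average degree is `2 * d`, so some degree is at most `2
    -- * d`.
    obtain ⟨G, hG, hGE⟩ := G₀.exists_le_card_edgeFinset_eq hE
    suffices h : ∃ (W : Type) (_ : Fintype W) (H : SimpleGraph W), Nonempty W ∧
        IsGraphMinor H G ∧ Fintype.card W ≤ 2 * d ∧ ∀ w, d ≤ H.degree w by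
      obtain ⟨W, i, H, h1, h2, h3⟩ := h
      exact ⟨W, i, H, h1, h2.trans (.of_le hG), h3⟩
    obtain ⟨v, hv⟩ : ∃ v, G.degree v ≤ 2 * d := by
      by_contra! hcon
      have h1 := G.sum_degrees_eq_twice_card_edges
      have h2 : ∑ v : V, (2 * d) < ∑ v, G.degree v :=
        Finset.sum_lt_sum_of_nonempty Finset.univ_nonempty fun v _ => hcon v
      rw [h1, hGE] at h2
      simp only [Finset.sum_const, Finset.card_univ, hn, smul_eq_mul] at h2
      nlinarith
    have hcard : ∀ v : V, Fintype.card ({v}ᶜ : Set V) = n := fun v => by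
      rw [Fintype.card_compl_set]
      simp [hn]
    by_cases hv0 : G.degree v = 0
    · have h1 := G.card_edgeFinset_induce_compl_singleton v
      have h3 := G.card_edgeFinset_deleteIncidenceSet v
      have h4 : (G.induce {v}ᶜ).edgeFinset.card = d * (n + 1) := by
        have : (G.induce {v}ᶜ).edgeFinset.card = G.edgeFinset.card - G.degree v := by
          rw [← h3]
          convert h1
        rw [this, hv0, hGE, Nat.sub_zero]
      have hne : Nonempty ({v}ᶜ : Set V) := by
        have : (G.induce {v}ᶜ).edgeFinset.Nonempty := by
          rw [← Finset.card_pos, h4]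
          positivity
        obtain ⟨e, -⟩ := this
        induction e using Sym2.ind with
        | _ x y => exact ⟨x⟩
      obtain ⟨W, i, H, h1, h2, h3⟩ := ih _ (G.induce {v}ᶜ) (hcard v)
        (((Nat.mul_le_mul_left d (Nat.le_succ n)).trans h4.ge).trans_eq (by congr!))
      exact ⟨W, i, H, h1, h2.trans (.induce _ _), h3⟩
    -- Contracting an edge in fewer than `d` triangles costs at most `d` edges and one vertex, so
    -- induction applies. If there is none, the neighbourhood of `v` is the required minor.
    by_cases htri : ∃ u w, G.Adj u w ∧ (G.neighborFinset u ∩ G.neighborFinset w).card < d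
    · obtain ⟨u, w, huw, hlt⟩ := htri
      have h1 := G.card_edgeFinset_le_mergeInto huw
      have hne : Nonempty ({w}ᶜ : Set V) := ⟨⟨u, huw.ne⟩⟩
      have h2 : d * n ≤ ((G.mergeInto u w).induce {w}ᶜ).edgeFinset.card := by
        rw [hGE, Nat.mul_succ] at h1
        omega
      obtain ⟨W, i, H, h1, h2, h3⟩ := ih _ ((G.mergeInto u w).induce {w}ᶜ) (hcard w)
        (h2.trans_eq (by congr!))
      exact ⟨W, i, H, h1, h2.trans (.mergeInto huw), h3⟩
    · push Not at htri
      refine ⟨G.neighborSet v, inferInstance, G.induce (G.neighborSet v), ?_, .induce _ _, ?_,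
        fun w => ?_⟩
      · rw [Set.nonempty_coe_sort, ← Set.toFinset_nonempty, ← Finset.card_pos]
        exact Nat.pos_of_ne_zero hv0
      · rw [SimpleGraph.card_neighborSet_eq_degree]
        exact hv
      · refine (htri v w w.2).trans ?_
        have := congrArg Finset.card (G.map_neighborFinset_induce w)
        rw [Finset.card_map, SimpleGraph.card_neighborFinset_eq_degree, Finset.inter_comm] at this
        refine le_of_eq ?_
        convert this.symm
        ext; simp

/-! ### Robust short connections -/

/-- Any two vertices are joined by a path with at most three edges that avoids a prescribed set
containing at most one sixteenth of the vertices. -/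
def SimpleGraph.RobustlyLinked {W : Type*} [Fintype W] (H : SimpleGraph W) : Prop :=
  ∀ R : Finset W, 16 * R.card ≤ Fintype.card W → ∀ x ∉ R, ∀ y ∉ R, ∃ a ∉ R, ∃ b ∉ R,
    (x = a ∨ H.Adj x a) ∧ (a = b ∨ H.Adj a b) ∧ (b = y ∨ H.Adj b y)

open Classical in
theorem SimpleGraph.robustlyLinked_of_dense {W : Type*} [Fintype W] (H : SimpleGraph W) (k : ℕ)
    (hk : 33 * k < 15 * Fintype.card W) (hdeg : ∀ w, Fintype.card W ≤ H.degree w + k) :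
    H.RobustlyLinked := by
  intro R hR x hx y hy
  have h1 := Finset.card_union_add_card_inter (H.neighborFinset x) (H.neighborFinset y)
  have h2 := Finset.card_le_univ (H.neighborFinset x ∪ H.neighborFinset y)
  have h3 := hdeg x
  have h4 := hdeg y
  have h5 := H.card_neighborFinset_eq_degree x
  have h6 := H.card_neighborFinset_eq_degree y
  obtain ⟨a, ha, haR⟩ : ∃ a ∈ H.neighborFinset x ∩ H.neighborFinset y, a ∉ R := by
    by_contra! hcon
    have := Finset.card_le_card (show H.neighborFinset x ∩ H.neighborFinset y ⊆ R from hcon)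
    omega
  simp only [Finset.mem_inter, SimpleGraph.mem_neighborFinset] at ha
  exact ⟨a, haR, a, haR, Or.inr ha.1, Or.inl rfl, Or.inr ha.2.symm⟩

open Classical in
-- If linking fails for `x`, `y` and `R`, their neighbourhoods outside `R` are disjoint with no
-- edges between them. Each has nearly half of the vertices, so the one at `x` induces a nearly
-- complete graph, where common neighbours give the links.
theorem exists_minor_robustlyLinked {V : Type} [Fintype V] [Nonempty V] (G : SimpleGraph V)
    (hdeg : ∀ v, Fintype.card V ≤ 2 * G.degree v) :
    ∃ (W : Type) (_ : Fintype W) (H : SimpleGraph W), IsGraphMinor H G ∧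
      7 * Fintype.card V ≤ 16 * Fintype.card W ∧ (∀ w, 3 * Fintype.card W ≤ 8 * H.degree w) ∧
      H.RobustlyLinked := by
  by_cases hl : G.RobustlyLinked
  · exact ⟨V, inferInstance, G, .of_le le_rfl, by omega, fun w => by have := hdeg w; omega, hl⟩
  simp only [SimpleGraph.RobustlyLinked] at hl
  push Not at hl
  obtain ⟨R, hR, x, hx, y, hy, hno⟩ := hl
  set n := Fintype.card V with hn
  have hnpos : 0 < n := Fintype.card_pos
  set X := G.neighborFinset x \ R with hX
  set Y := G.neighborFinset y \ R with hY
  have memX : ∀ {a}, a ∈ X ↔ G.Adj x a ∧ a ∉ R := by simp [hX]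
  have memY : ∀ {a}, a ∈ Y ↔ G.Adj y a ∧ a ∉ R := by simp [hY]
  have cardX : G.degree x ≤ X.card + R.card := by
    rw [← SimpleGraph.card_neighborFinset_eq_degree]
    refine (Finset.card_le_card fun a ha => ?_).trans (Finset.card_union_le X R)
    rw [SimpleGraph.mem_neighborFinset] at ha
    by_cases h : a ∈ R <;> simp [h, memX, ha]
  have cardY : G.degree y ≤ Y.card + R.card := by
    rw [← SimpleGraph.card_neighborFinset_eq_degree]
    refine (Finset.card_le_card fun a ha => ?_).trans (Finset.card_union_le Y R)
    rw [SimpleGraph.mem_neighborFinset] at ha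
    by_cases h : a ∈ R <;> simp [h, memY, ha]
  have hXY : ∀ a ∈ X, ∀ b ∈ Y, a ≠ b ∧ ¬ G.Adj a b := by
    intro a ha b hb
    rw [memX] at ha
    rw [memY] at hb
    have h := hno a ha.2 b hb.2 (Or.inr ha.1)
    exact ⟨fun e => (h (Or.inl e)).2 hb.1.symm, fun e => (h (Or.inr e)).2 hb.1.symm⟩
  have hin : ∀ a ∈ X, X.card ≤ (G.neighborFinset a ∩ X).card + R.card := by
    intro a ha
    -- As `Y` has at least `n / 2 - |R|` vertices, its complement is too small for `a` to miss more
    -- than `|R|` of `X`.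
    have h1 : G.neighborFinset a ∪ X ⊆ Yᶜ := by
      intro b hb
      rw [Finset.mem_compl]
      intro hbY
      rcases Finset.mem_union.1 hb with h | h
      · exact (hXY a ha b hbY).2 (by simpa using h)
      · exact (hXY b h b hbY).1 rfl
    have h2 := Finset.card_le_card h1
    rw [Finset.card_compl] at h2
    have h3 := Finset.card_union_add_card_inter (G.neighborFinset a) X
    have h4 := hdeg a
    have h5 := hdeg y
    have h6 := Finset.card_le_univ Y
    rw [SimpleGraph.card_neighborFinset_eq_degree] at h3
    omega
  have hcardW : Fintype.card (X : Set V) = X.card := by simp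
  have hdegW : ∀ w : (X : Set V), X.card ≤ (G.induce (X : Set V)).degree w + R.card := by
    intro w
    have h1 := congrArg Finset.card (G.map_neighborFinset_induce w)
    rw [Finset.card_map, SimpleGraph.card_neighborFinset_eq_degree] at h1
    have h2 := hin w w.2
    have h3 : (G.induce (X : Set V)).degree w = (G.neighborFinset w ∩ X).card := by
      convert h1 using 2
      ext; simp
    omega
  have hXn : 7 * n ≤ 16 * X.card := by
    have := hdeg x
    omega
  refine ⟨(X : Set V), inferInstance, G.induce (X : Set V), .induce _ _, ?_, fun w => ?_, ?_⟩
  · rw [hcardW]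
    exact hXn
  · have h1 := hdegW w
    have h2 : 3 * X.card ≤ 8 * (G.induce (X : Set V)).degree w := by omega
    rw [hcardW]
    convert h2
  · refine SimpleGraph.robustlyLinked_of_dense _ R.card ?_ fun w => ?_
    · rw [hcardW]
      omega
    · rw [hcardW]
      exact hdegW w

open Classical in
-- Linking the first entry to every entry costs at most two inner vertices per entry.
theorem SimpleGraph.exists_connected_superset {W : Type*} [Fintype W] {H : SimpleGraph W}
    (hl : H.RobustlyLinked) {R : Finset W} (hR : 16 * R.card ≤ Fintype.card W) {s : ℕ}
    (hs : 0 < s) (f : Fin s → W) (hf : ∀ j, f j ∉ R) :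
    ∃ A : Finset W, (∀ j, f j ∈ A) ∧ Disjoint A R ∧ A.card ≤ 3 * s ∧
      (H.induce (A : Set W)).Connected := by
  choose a haR b hbR h1 h2 h3 using fun j => hl R hR (f ⟨0, hs⟩) (hf _) (f j) (hf j)
  refine ⟨Finset.univ.image f ∪ Finset.univ.image a ∪ Finset.univ.image b, fun j => by simp, ?_,
    ?_, ?_⟩
  · rw [Finset.disjoint_left]
    intro x hx
    simp only [Finset.mem_union, Finset.mem_image, Finset.mem_univ, true_and] at hx
    rcases hx with (⟨j, rfl⟩ | ⟨j, rfl⟩) | ⟨j, rfl⟩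
    exacts [hf j, haR j, hbR j]
  · have e : ∀ g : Fin s → W, (Finset.univ.image g).card ≤ s := fun g =>
      Finset.card_image_le.trans (by simp)
    have := Finset.card_union_le (Finset.univ.image f ∪ Finset.univ.image a)
      (Finset.univ.image b)
    have := Finset.card_union_le (Finset.univ.image f) (Finset.univ.image a)
    have := e f
    have := e a
    have := e b
    omega
  · rw [SimpleGraph.connected_induce_iff_closed]
    refine ⟨f ⟨0, hs⟩, by simp, fun P hP hcl => ?_⟩
    have step : ∀ x y, x ∈ Finset.univ.image f ∪ Finset.univ.image a ∪ Finset.univ.image b →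
        y ∈ Finset.univ.image f ∪ Finset.univ.image a ∪ Finset.univ.image b →
        (x = y ∨ H.Adj x y) → P x → P y := by
      rintro x y hx hy (rfl | h) hPx
      · exact hPx
      · exact hcl x hx y hy h hPx
    have ha : ∀ j, P (a j) := fun j => step _ _ (by simp) (by simp) (h1 j) hP
    have hb : ∀ j, P (b j) := fun j => step _ _ (by simp) (by simp) (h2 j) (ha j)
    have hc : ∀ j, P (f j) := fun j => step _ _ (by simp) (by simp) (h3 j) (hb j)
    intro x hx
    rw [Finset.mem_coe] at hx
    simp only [Finset.mem_union, Finset.mem_image, Finset.mem_univ, true_and] at hx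
    rcases hx with (⟨j, rfl⟩ | ⟨j, rfl⟩) | ⟨j, rfl⟩
    exacts [hc j, ha j, hb j]

/-! ### Greedy construction of a complete minor -/

open Classical in
/-- Some `s`-tuple avoids `R`, is contained in none of the small sets `U i`, and has few common
non-neighbours. -/
theorem SimpleGraph.exists_tuple {W : Type*} [Fintype W] [Nonempty W] {H : SimpleGraph W}
    (hdeg : ∀ w, 3 * Fintype.card W ≤ 8 * H.degree w) {R : Finset W}
    (hR : 16 * R.card ≤ Fintype.card W) {s t k : ℕ} (hkt : k ≤ t)
    (hst : 2 * t * ((32 / 15 : ℝ) * (11 / 16) ^ s) ^ s < 1) (U : ℕ → Finset W)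
    (hU : ∀ i < k, ((U i).card : ℝ) ≤ 2 * (11 / 16) ^ s * Fintype.card W) :
    ∃ f : Fin s → W, (∀ j, f j ∉ R) ∧ (∀ i < k, ∃ j, f j ∉ U i) ∧
      ((Finset.univ.filter fun w => ∀ j, ¬ H.Adj w (f j)).card : ℝ) ≤
        2 * (11 / 16) ^ s * Fintype.card W := by
  set m := Fintype.card W with hm
  have hmpos : (0 : ℝ) < m := by exact_mod_cast Fintype.card_pos
  set L : ℝ := 2 * (11 / 16) ^ s * m with hL
  have hLpos : 0 < L := by positivity
  set N : ℝ := (Rᶜ.card : ℝ) with hN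
  have hNm : 15 * (m : ℝ) ≤ 16 * N := by
    have : 15 * m ≤ 16 * Rᶜ.card := by
      rw [Finset.card_compl]
      omega
    rw [hN]
    exact_mod_cast this
  have hNm' : N ≤ m := Nat.cast_le.2 (Finset.card_le_univ Rᶜ)
  have hNpos : 0 < N := by linarith
  by_contra! hcon
  -- Among the tuples outside `R`, those inside some `U i` make up less than half by `hst`, and
  -- those with more than `L` common non-neighbours at most half by Markov's inequality, `L` being
  -- twice a bound on the mean.
  let T : Finset (Fin s → W) := Fintype.piFinset fun _ => Rᶜ
  let B : (Fin s → W) → Finset W := fun f => Finset.univ.filter fun w => ∀ j, ¬ H.Adj w (f j)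
  let Bad := T.filter fun f => L < (B f).card
  have hT : (T.card : ℝ) = N ^ s := by simp [T, hN]
  have hcover : T ⊆ ((Finset.range k).biUnion fun i => Fintype.piFinset fun _ => U i) ∪ Bad := by
    intro f hf
    rw [Finset.mem_union]
    by_cases h : ∃ i < k, ∀ j, f j ∈ U i
    · obtain ⟨i, hi, hj⟩ := h
      exact Or.inl (Finset.mem_biUnion.2 ⟨i, by simpa using hi, by simpa using hj⟩)
    · push Not at h
      have hf' : ∀ j, f j ∉ R := by simpa [T] using hf
      exact Or.inr (Finset.mem_filter.2 ⟨hf, hcon f hf' h⟩)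
  have hbad1 : ((((Finset.range k).biUnion fun i => Fintype.piFinset fun (_ : Fin s) => U i).card :
      ℕ) : ℝ) ≤ t * L ^ s := by
    refine (Nat.cast_le.2 Finset.card_biUnion_le).trans ?_
    push_cast
    refine (Finset.sum_le_card_nsmul _ _ (L ^ s) fun i hi => ?_).trans ?_
    · simp only [Fintype.card_piFinset, Finset.prod_const, Finset.card_univ, Fintype.card_fin,
        Nat.cast_pow]
      exact pow_le_pow_left₀ (by positivity) (hU i (Finset.mem_range.1 hi)) _
    · rw [Finset.card_range, nsmul_eq_mul]
      gcongr
  have hbad2 : (Bad.card : ℝ) * L ≤ m * ((11 / 16) * N) ^ s := by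
    calc (Bad.card : ℝ) * L = ∑ f ∈ Bad, L := by rw [Finset.sum_const, nsmul_eq_mul]
      _ ≤ ∑ f ∈ Bad, ((B f).card : ℝ) :=
        Finset.sum_le_sum fun f hf => (Finset.mem_filter.1 hf).2.le
      _ ≤ ∑ f ∈ T, ((B f).card : ℝ) :=
        Finset.sum_le_sum_of_subset_of_nonneg (Finset.filter_subset _ _)
          fun _ _ _ => by positivity
      _ = ∑ w : W, (((T.filter fun f => ∀ j, ¬ H.Adj w (f j)).card : ℕ) : ℝ) := by
        rw [← Nat.cast_sum, ← Nat.cast_sum]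
        congr 1
        exact Finset.sum_card_bipartiteAbove_eq_sum_card_bipartiteBelow
          (r := fun f w => ∀ j, ¬ H.Adj w (f j)) (s := T) (t := Finset.univ)
      _ ≤ ∑ w : W, ((11 / 16) * N) ^ s := by
        refine Finset.sum_le_sum fun w _ => ?_
        have h1 : (T.filter fun f => ∀ j, ¬ H.Adj w (f j)) =
            Fintype.piFinset fun _ => Rᶜ \ H.neighborFinset w := by
          ext f
          simp [T, forall_and]
        rw [h1]
        simp only [Fintype.card_piFinset, Finset.prod_const, Finset.card_univ, Fintype.card_fin,
          Nat.cast_pow]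
        refine pow_le_pow_left₀ (by positivity) ?_ _
        have h2 : (Rᶜ \ H.neighborFinset w).card + (H.neighborFinset w).card ≤ Rᶜ.card + R.card := by
          rw [← Finset.card_union_of_disjoint Finset.sdiff_disjoint, add_comm Rᶜ.card,
            Finset.card_add_card_compl]
          exact Finset.card_le_univ _
        rw [SimpleGraph.card_neighborFinset_eq_degree] at h2
        have h3 : 3 * (m : ℝ) ≤ 8 * H.degree w := by exact_mod_cast hdeg w
        have h4 : (16 * R.card : ℝ) ≤ m := by exact_mod_cast hR
        have h5 : ((Rᶜ \ H.neighborFinset w).card : ℝ) + H.degree w ≤ N + R.card := by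
          rw [hN]
          exact_mod_cast h2
        -- A vertex has at most `N + m / 16 - 3 * m / 8 = N - 5 * m / 16` non-neighbours outside
        -- `R`, and `N ≤ m`; this gives the factor `11 / 16`.
        linarith
      _ = m * ((11 / 16) * N) ^ s := by rw [Finset.sum_const, nsmul_eq_mul, Finset.card_univ]
  have hbad2' : (Bad.card : ℝ) ≤ N ^ s / 2 := by
    have e : (m : ℝ) * ((11 / 16) * N) ^ s = N ^ s / 2 * L := by
      rw [hL, mul_pow]
      ring
    rw [e] at hbad2
    exact le_of_mul_le_mul_right hbad2 hLpos
  have hbad1' : (t : ℝ) * L ^ s < N ^ s / 2 := by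
    have e : L ≤ ((32 / 15 : ℝ) * (11 / 16) ^ s) * N := by
      have : (0 : ℝ) < (11 / 16) ^ s := by positivity
      rw [hL]
      nlinarith
    have e2 : L ^ s ≤ ((32 / 15 : ℝ) * (11 / 16) ^ s) ^ s * N ^ s := by
      rw [← mul_pow]
      exact pow_le_pow_left₀ hLpos.le e _
    have e3 : 0 < N ^ s := by positivity
    have e4 : (t : ℝ) * L ^ s ≤ t * (((32 / 15 : ℝ) * (11 / 16) ^ s) ^ s * N ^ s) := by gcongr
    nlinarith
  have h1 := Finset.card_le_card hcover
  have h2 : (T.card : ℝ) ≤ (((Finset.range k).biUnion fun i =>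
      Fintype.piFinset fun (_ : Fin s) => U i).card : ℝ) + Bad.card := by
    exact_mod_cast h1.trans (Finset.card_union_le _ _)
  linarith

open Classical in
-- The induction keeps every branch set adjacent to almost all vertices. A new tuple not contained
-- in the exceptional set of any earlier branch set is then adjacent to all of them, and linking it
-- up avoids the at most `3 * s * t` used vertices.
theorem SimpleGraph.RobustlyLinked.isGraphMinor {W : Type*} [Fintype W] {H : SimpleGraph W}
    (hl : H.RobustlyLinked) (hdeg : ∀ w, 3 * Fintype.card W ≤ 8 * H.degree w) {s t : ℕ}
    (hs : 0 < s) (hm : 48 * s * t ≤ Fintype.card W)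
    (hst : 2 * t * ((32 / 15 : ℝ) * (11 / 16) ^ s) ^ s < 1) :
    IsGraphMinor (SimpleGraph.completeGraph (Fin t)) H := by
  suffices h : ∀ k ≤ t, ∃ A : ℕ → Finset W,
      (∀ i < k, (H.induce (A i : Set W)).Connected ∧ (A i).card ≤ 3 * s ∧
        ((Finset.univ.filter fun w => ∀ v ∈ A i, ¬ H.Adj w v).card : ℝ) ≤
          2 * (11 / 16) ^ s * Fintype.card W) ∧
      (∀ i < k, ∀ j < i, Disjoint (A i) (A j) ∧ ∃ x ∈ A i, ∃ y ∈ A j, H.Adj x y) by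
    obtain ⟨A, hA, hA'⟩ := h t le_rfl
    refine ⟨fun i => A i, fun i => (hA i i.2).1, fun i j hij => ?_, fun i j hij => ?_⟩
    · rw [Finset.disjoint_coe]
      rcases lt_or_gt_of_ne hij with h | h
      · exact (hA' j j.2 i h).1.symm
      · exact (hA' i i.2 j h).1
    · rcases lt_or_gt_of_ne (SimpleGraph.Adj.ne hij) with h | h
      · obtain ⟨x, hx, y, hy, hxy⟩ := (hA' j j.2 i h).2
        exact ⟨y, hy, x, hx, hxy.symm⟩
      · exact (hA' i i.2 j h).2
  intro k
  induction k with
  | zero => exact fun _ => ⟨fun _ => ∅, fun i hi => absurd hi (Nat.not_lt_zero i),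
      fun i hi => absurd hi (Nat.not_lt_zero i)⟩
  | succ k ih =>
    intro hk
    obtain ⟨A, hA, hA'⟩ := ih (by omega)
    have hne : Nonempty W := by
      rw [← Fintype.card_pos_iff]
      exact lt_of_lt_of_le (Nat.mul_pos (by omega) (by omega)) hm
    set R := (Finset.range k).biUnion A with hRdef
    have hR : 16 * R.card ≤ Fintype.card W := by
      have h1 : R.card ≤ k * (3 * s) := by
        refine (Finset.card_biUnion_le_card_mul _ _ _ fun i hi =>
          (hA i (Finset.mem_range.1 hi)).2.1).trans_eq ?_
        rw [Finset.card_range]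
      refine le_trans ?_ hm
      calc 16 * R.card ≤ 16 * (t * (3 * s)) := by
            refine Nat.mul_le_mul_left _ (h1.trans (Nat.mul_le_mul_right _ (by omega)))
        _ = 48 * s * t := by ring
    obtain ⟨f, hfR, hfU, hfB⟩ := SimpleGraph.exists_tuple hdeg hR (show k ≤ t by omega) hst
      (fun i => Finset.univ.filter fun w => ∀ v ∈ A i, ¬ H.Adj w v) fun i hi => (hA i hi).2.2
    obtain ⟨D, hfD, hDR, hDc, hDconn⟩ := SimpleGraph.exists_connected_superset hl hR hs f hfR
    have hlast : ∀ i < k, Function.update A k D i = A i := fun i hi =>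
      Function.update_of_ne hi.ne _ _
    refine ⟨Function.update A k D, fun i hi => ?_, fun i hi j hj => ?_⟩
    · rcases Nat.lt_succ_iff_lt_or_eq.1 hi with h | rfl
      · rw [hlast i h]
        exact hA i h
      · rw [Function.update_self]
        refine ⟨hDconn, hDc, le_trans (Nat.cast_le.2 (Finset.card_le_card ?_)) hfB⟩
        intro w hw
        simp only [Finset.mem_filter, Finset.mem_univ, true_and] at hw ⊢
        exact fun j => hw _ (hfD j)
    · rcases Nat.lt_succ_iff_lt_or_eq.1 hi with h | rfl
      · rw [hlast i h, hlast j (hj.trans h)]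
        exact hA' i h j hj
      · rw [Function.update_self, hlast j hj]
        refine ⟨hDR.mono_right (Finset.subset_biUnion_of_mem A (Finset.mem_range.2 hj)), ?_⟩
        obtain ⟨l, hl⟩ := hfU j hj
        simp only [Finset.mem_filter, Finset.mem_univ, true_and, not_forall, not_not] at hl
        obtain ⟨v, hv, hadj⟩ := hl
        exact ⟨f l, hfD l, v, hv, hadj⟩

theorem two_mul_mul_pow_lt_one {t s : ℕ} (ht : 2 ≤ t) (hs : 4 * √(Real.log t) + 6 ≤ s) :
    2 * t * ((32 / 15 : ℝ) * (11 / 16) ^ s) ^ s < 1 := by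
  have ht' : (0 : ℝ) < t := by positivity
  have hsq := Real.sqrt_nonneg (Real.log t)
  have hlog : 0 ≤ Real.log t := Real.log_natCast_nonneg t
  have hs6 : (6 : ℝ) ≤ s := by linarith
  have hq : Real.log (11 / 16) ≤ -(5 / 16) := by
    have := Real.log_le_sub_one_of_pos (show (0 : ℝ) < 11 / 16 by norm_num)
    linarith
  have hr : Real.log (32 / 15) ≤ -3 * Real.log (11 / 16) := by
    rw [show (-3 : ℝ) * Real.log (11 / 16) = Real.log ((16 / 11) ^ 3) by
      rw [Real.log_pow, show (16 / 11 : ℝ) = (11 / 16)⁻¹ by norm_num, Real.log_inv]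
      push_cast
      ring]
    exact Real.log_le_log (by norm_num) (by norm_num)
  have hs2 : 16 * Real.log t + 36 ≤ (s : ℝ) ^ 2 := by
    have := Real.sq_sqrt hlog
    nlinarith
  rw [← Real.log_neg_iff (by positivity), Real.log_mul (by positivity) (by positivity),
    Real.log_mul (by norm_num) ht'.ne', Real.log_pow, Real.log_mul (by norm_num) (by positivity),
    Real.log_pow]
  have h2 := Real.log_two_lt_d9
  -- Here `s ≥ 6` lets half of the negative term absorb `log (32 / 15)`.
  have h3 : Real.log (32 / 15) + s * Real.log (11 / 16) ≤ s / 2 * Real.log (11 / 16) := by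
    nlinarith
  have h4 : s / 2 * Real.log (11 / 16) ≤ s / 2 * -(5 / 16) := by gcongr
  have h5 : (s : ℝ) * (Real.log (32 / 15) + s * Real.log (11 / 16)) ≤ s * (s / 2 * -(5 / 16)) :=
    mul_le_mul_of_nonneg_left (h3.trans h4) (by positivity)
  nlinarith

/-! ### The bound on the extremal function -/

theorem isGraphMinor_of_le_averageDegree {t : ℕ} (ht : 2 ≤ t) {V : Type} [Fintype V] [Nonempty V]
    (G : SimpleGraph V) (hG : 2860 * (t * √(Real.log t)) ≤ averageDegree G) :
    IsGraphMinor (SimpleGraph.completeGraph (Fin t)) G := by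
  classical
  set s := ⌈4 * √(Real.log t)⌉₊ + 6 with hs
  have hs1 : 4 * √(Real.log t) + 6 ≤ s := by
    rw [hs]
    push_cast
    linarith [Nat.le_ceil (4 * √(Real.log t))]
  have hlog : (7 / 9 : ℝ) ≤ √(Real.log t) := by
    refine Real.le_sqrt_of_sq_le ?_
    have h1 := Real.log_two_gt_d9
    have h2 : Real.log 2 ≤ Real.log t := Real.log_le_log (by norm_num) (by exact_mod_cast ht)
    linarith
  have hs2 : (s : ℝ) ≤ 13 * √(Real.log t) := by
    have := Nat.ceil_lt_add_one (show 0 ≤ 4 * √(Real.log t) by positivity)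
    rw [hs]
    push_cast
    linarith
  have hspos : 0 < s := by omega
  -- Passing to the linked minor keeps `7 / 16` of the vertices, and `110 * 7 / 16 > 48`. With `s ≤
  -- 13 * √(log t)`, an average degree of `220 * s * t` is covered by `2860 = 220 * 13`.
  have hd : 1 ≤ 110 * s * t := Nat.mul_pos (by omega) (by omega)
  have hE : 110 * s * t * Fintype.card V ≤ G.edgeFinset.card := by
    have hpos : (0 : ℝ) < Fintype.card V := by exact_mod_cast Fintype.card_pos
    rw [averageDegree, le_div_iff₀ hpos] at hG
    have h1 : (∑ v, (G.degree v : ℝ)) = 2 * G.edgeFinset.card := by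
      exact_mod_cast G.sum_degrees_eq_twice_card_edges
    have h2 : 2860 * (t * √(Real.log t)) * Fintype.card V ≤ 2 * (G.edgeFinset.card : ℝ) := by
      rw [← h1]
      convert hG
    have h3 : 220 * (t : ℝ) * s ≤ 2860 * (t * √(Real.log t)) := by
      have : (t : ℝ) * s ≤ t * (13 * √(Real.log t)) := by gcongr
      linarith
    have h4 : 220 * (t : ℝ) * s * Fintype.card V ≤ 2 * G.edgeFinset.card :=
      (mul_le_mul_of_nonneg_right h3 hpos.le).trans h2
    have h5 : ((110 * s * t * Fintype.card V : ℕ) : ℝ) ≤ (G.edgeFinset.card : ℕ) := by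
      push_cast
      linarith
    exact_mod_cast h5
  obtain ⟨W, _, H, _, hHG, hW, hH⟩ := exists_minor_minDegree hd _ V G rfl hE
  obtain ⟨X, _, K, hKH, hX, hK, hl⟩ := exists_minor_robustlyLinked H fun w => by
    have := hH w
    omega
  refine ((hl.isGraphMinor hK hspos ?_ (two_mul_mul_pow_lt_one ht hs1)).trans hKH).trans hHG
  obtain ⟨w⟩ := ‹Nonempty W›
  have h1 := (hH w).trans (H.degree_lt_card_verts w).le
  have h2 : 110 * s * t = 110 * (s * t) := by ring
  have h3 : 48 * s * t = 48 * (s * t) := by ring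
  omega

theorem exists_isKostochkaThomasonConstant : ∃ c : ℝ, IsKostochkaThomasonConstant c := by
  refine ⟨2860, by norm_num, 0, tendsto_const_nhds, fun t ht => sInf_le ⟨_, rfl, ?_⟩⟩
  intro V _ hV G hG
  rcases ht.eq_or_lt with rfl | ht
  · obtain ⟨v⟩ := hV
    exact .of_injective (fun _ => v) (fun _ _ _ => Subsingleton.elim _ _)
      fun x y h => absurd (Subsingleton.elim x y) h.ne
  · exact isGraphMinor_of_le_averageDegree ht G (by simpa using hG)

/-! ### Two-colourings and bipartite subgraphs -/

/-- The spanning subgraph of the edges whose ends get different colours. -/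
def SimpleGraph.bichromatic {V : Type*} (G : SimpleGraph V) (κ : V → Bool) : SimpleGraph V where
  Adj x y := G.Adj x y ∧ κ x ≠ κ y
  symm := ⟨fun _ _ h => ⟨h.1.symm, h.2.symm⟩⟩
  loopless := ⟨fun _ h => h.2 rfl⟩

theorem SimpleGraph.bichromatic_le {V : Type*} (G : SimpleGraph V) (κ : V → Bool) :
    G.bichromatic κ ≤ G := fun _ _ h => h.1

theorem SimpleGraph.isBipartite_bichromatic {V : Type*} (G : SimpleGraph V) (κ : V → Bool) :
    (G.bichromatic κ).IsBipartite := by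
  have C : (G.bichromatic κ).Coloring Bool := SimpleGraph.Coloring.mk κ fun h => h.2
  simpa using C.colorable

/-- The vertices of a connected graph can be 2-coloured so that the bichromatic edges form a
connected subgraph. -/
theorem SimpleGraph.Connected.exists_connected_bichromatic {V : Type*} {G : SimpleGraph V}
    (h : G.Connected) : ∃ κ : V → Bool, (G.bichromatic κ).Connected := by
  obtain ⟨T, hTG, hT⟩ := h.exists_isTree_le
  refine ⟨fun v => hT.coloringTwo v = 0, hT.connected.mono fun x y hxy => ⟨hTG hxy, ?_⟩⟩
  have := hT.coloringTwo.valid hxy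
  rw [ne_eq, decide_eq_decide]
  omega

open Classical in
/-- Among all switchings of a symmetric 0/1 pattern some switching has at least half of the
off-diagonal pairs. -/
theorem exists_switching {ι : Type*} [Fintype ι] (p : ι → ι → Bool) :
    ∃ σ : ι → Bool, (Fintype.card ι) * (Fintype.card ι - 1) ≤
      2 * ∑ i, (Finset.univ.filter fun j => i ≠ j ∧ xor (σ i) (σ j) = p i j).card := by
  by_contra! hcon
  set n := Fintype.card ι with hn
  let g : (ι → Bool) → ℕ := fun σ =>
    ∑ i, (Finset.univ.filter fun j => i ≠ j ∧ xor (σ i) (σ j) = p i j).card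
  have hlt : ∑ σ : ι → Bool, 2 * g σ < ∑ σ : ι → Bool, n * (n - 1) :=
    Finset.sum_lt_sum_of_nonempty Finset.univ_nonempty fun σ _ => hcon σ
  have heq : ∑ σ : ι → Bool, 2 * g σ = ∑ σ : ι → Bool, n * (n - 1) := by
    have h1 : ∀ i j, i ≠ j →
        2 * ∑ σ : ι → Bool, (if xor (σ i) (σ j) = p i j then 1 else 0) =
          ∑ σ : ι → Bool, 1 := by
      intro i j hij
      -- Flipping `σ i` pairs up the switchings so that exactly one of each pair matches the pattern
      -- at `(i, j)`.
      let e : (ι → Bool) → (ι → Bool) := fun σ => Function.update σ i (!σ i)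
      have he : Function.Involutive e := fun σ => by
        simp [e]
      rw [two_mul]
      nth_rewrite 2 [← Equiv.sum_comp he.toPerm]
      rw [← Finset.sum_add_distrib]
      refine Finset.sum_congr rfl fun σ _ => ?_
      simp only [Function.Involutive.coe_toPerm, e, Function.update_self,
        Function.update_of_ne hij.symm]
      cases σ i <;> cases σ j <;> cases p i j <;> rfl
    have h2 : ∀ σ, g σ = ∑ i, ∑ j ∈ Finset.univ.erase i,
        (if xor (σ i) (σ j) = p i j then 1 else 0) := by
      intro σ
      refine Finset.sum_congr rfl fun i _ => ?_
      rw [← Finset.card_filter]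
      congr 1
      ext j
      simp [eq_comm]
    simp only [h2]
    rw [← Finset.mul_sum, Finset.sum_comm, Finset.mul_sum]
    have h3 : ∀ i : ι, 2 * ∑ σ : ι → Bool, ∑ j ∈ Finset.univ.erase i,
        (if xor (σ i) (σ j) = p i j then 1 else 0) = (n - 1) * ∑ σ : ι → Bool, 1 := by
      intro i
      rw [Finset.sum_comm, Finset.mul_sum, Finset.sum_congr rfl fun j hj =>
        h1 i j (Finset.ne_of_mem_erase hj).symm, Finset.sum_const,
        Finset.card_erase_of_mem (Finset.mem_univ _), Finset.card_univ, smul_eq_mul]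
    rw [Finset.sum_congr rfl fun i _ => h3 i, Finset.sum_const, Finset.sum_const, Finset.sum_const,
      Finset.card_univ]
    simp only [smul_eq_mul]
    ring
  omega

open Classical in
theorem IsGraphMinor.exists_bichromatic {V : Type*} {G : SimpleGraph V} {h : ℕ} (hpos : 0 < h)
    (hG : IsGraphMinor (SimpleGraph.completeGraph (Fin h)) G) :
    ∃ (κ : V → Bool) (F : SimpleGraph (Fin h)), IsGraphMinor F (G.bichromatic κ) ∧
      ((h : ℝ) - 1) / 2 ≤ averageDegree F := by
  obtain ⟨B, hBc, hBd, hBa⟩ := hG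
  choose κ hκ using fun i => (hBc i).exists_connected_bichromatic
  have hex : ∀ i j, ∃ e : V × V, i ≠ j → e.1 ∈ B i ∧ e.2 ∈ B j ∧ G.Adj e.1 e.2 := by
    intro i j
    by_cases hij : i = j
    · obtain ⟨x⟩ := (hBc i).nonempty
      exact ⟨(x, x), fun hn => absurd hij hn⟩
    · obtain ⟨x, hx, y, hy, hxy⟩ := hBa i j hij
      exact ⟨(x, y), fun _ => ⟨hx, hy, hxy⟩⟩
  choose e he using hex
  let col : Fin h → V → Bool := fun i x => if hx : x ∈ B i then κ i ⟨x, hx⟩ else false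
  -- The pattern asks to switch exactly one of the two sides when the chosen edge is monochromatic,
  -- and both or neither otherwise. Comparing `i` and `j` selects a single edge per unordered pair.
  obtain ⟨σ, hσ⟩ := exists_switching fun i j =>
    if i < j then !(xor (col i (e i j).1) (col j (e i j).2))
    else !(xor (col j (e j i).1) (col i (e j i).2))
  let lam : V → Bool := fun x => if hx : ∃ i, x ∈ B i then xor (σ hx.choose) (col hx.choose x)
    else false
  have hlam : ∀ i, ∀ x ∈ B i, lam x = xor (σ i) (col i x) := by
    intro i x hx
    have hex : ∃ i, x ∈ B i := ⟨i, hx⟩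
    have hi : hex.choose = i := by
      by_contra hne
      exact Set.disjoint_left.1 (hBd _ _ hne) hex.choose_spec hx
    simp only [lam, dif_pos hex, hi]
  let F : SimpleGraph (Fin h) :=
    { Adj := fun i j => i ≠ j ∧ ∃ x ∈ B i, ∃ y ∈ B j, (G.bichromatic lam).Adj x y
      symm := ⟨fun i j ⟨h1, x, hx, y, hy, hxy⟩ => ⟨h1.symm, y, hy, x, hx, hxy.symm⟩⟩
      loopless := ⟨fun i h => h.1 rfl⟩ }
  refine ⟨lam, F, ⟨B, fun i => ?_, hBd, fun i j hij => hij.2⟩, ?_⟩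
  · refine (hκ i).mono ?_
    rintro ⟨x, hx⟩ ⟨y, hy⟩ ⟨hxy, hne⟩
    refine ⟨hxy, ?_⟩
    change lam x ≠ lam y
    rw [hlam i x hx, hlam i y hy, show col i x = κ i ⟨x, hx⟩ from dif_pos hx,
      show col i y = κ i ⟨y, hy⟩ from dif_pos hy]
    simpa using hne
  · have hdeg : ∀ i, (Finset.univ.filter fun j => i ≠ j ∧ xor (σ i) (σ j) =
        if i < j then !(xor (col i (e i j).1) (col j (e i j).2))
        else !(xor (col j (e j i).1) (col i (e j i).2))).card ≤ F.degree i := by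
      intro i
      rw [← SimpleGraph.card_neighborFinset_eq_degree]
      refine Finset.card_le_card fun j hj => ?_
      obtain ⟨hij, hx⟩ := (Finset.mem_filter.1 hj).2
      rw [SimpleGraph.mem_neighborFinset]
      refine ⟨hij, ?_⟩
      split_ifs at hx with hlt
      · obtain ⟨h1, h2, h3⟩ := he i j hij
        refine ⟨_, h1, _, h2, h3, ?_⟩
        rw [hlam i _ h1, hlam j _ h2]
        revert hx
        cases σ i <;> cases σ j <;> cases col i (e i j).1 <;> cases col j (e i j).2 <;> simp
      · obtain ⟨h1, h2, h3⟩ := he j i hij.symm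
        refine ⟨_, h2, _, h1, h3.symm, ?_⟩
        rw [hlam i _ h2, hlam j _ h1]
        revert hx
        cases σ i <;> cases σ j <;> cases col j (e j i).1 <;> cases col i (e j i).2 <;> simp
    have h1 := hσ.trans (Nat.mul_le_mul_left 2 (Finset.sum_le_sum fun i _ =>
      (le_of_eq (by congr!)).trans (hdeg i)))
    rw [Fintype.card_fin] at h1
    have h2 : (h : ℝ) * (h - 1) ≤ 2 * ∑ i, (F.degree i : ℝ) := by
      have : ((h * (h - 1) : ℕ) : ℝ) ≤ ((2 * ∑ i, F.degree i : ℕ) : ℝ) := Nat.cast_le.2 h1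
      rwa [Nat.cast_mul, Nat.cast_pred hpos, Nat.cast_mul, Nat.cast_sum, Nat.cast_ofNat] at this
    have hpos' : (0 : ℝ) < h := by exact_mod_cast hpos
    rw [averageDegree, Fintype.card_fin, le_div_iff₀ hpos']
    have h3 : ((h : ℝ) - 1) / 2 * h ≤ ∑ i, (F.degree i : ℝ) := by linarith
    exact h3.trans_eq (by congr!)

theorem IsGraphMinor.le_hadwigerNumber {V : Type*} [Finite V] {G : SimpleGraph V} {t : ℕ}
    (h : IsGraphMinor (SimpleGraph.completeGraph (Fin t)) G) : t ≤ hadwigerNumber G :=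
  (isGreatest_hadwigerNumber G).2 h

theorem one_le_hadwigerNumber {V : Type*} [Finite V] [Nonempty V] (G : SimpleGraph V) :
    1 ≤ hadwigerNumber G :=
  IsGraphMinor.le_hadwigerNumber (.of_injective (fun _ => Classical.arbitrary V)
    (fun _ _ _ => Subsingleton.elim _ _) fun x y h => absurd (Subsingleton.elim x y) h.ne)

/-- If the extremal function is small, a complete minor of order `h` yields a bipartite subgraph
with a complete minor of order `t`. -/
theorem exists_isBipartite_of_extremalFunction_lt {V : Type*} [Finite V] [Nonempty V]
    (G : SimpleGraph V) {t : ℕ}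
    (ht : extremalFunction (SimpleGraph.completeGraph (Fin t)) <
      ((((hadwigerNumber G : ℝ) - 1) / 2 : ℝ) : EReal)) :
    ∃ G' : G.Subgraph, G'.coe.IsBipartite ∧ t ≤ hadwigerNumber G'.coe := by
  -- The infimum need not be attained; strictness supplies an admissible `d` below `(h - 1) / 2`.
  obtain ⟨_, ⟨d, rfl, hd⟩, hlt⟩ := sInf_lt_iff.1 ht
  obtain ⟨κ, F, hF, hdF⟩ :=
    IsGraphMinor.exists_bichromatic (one_le_hadwigerNumber G) (isGreatest_hadwigerNumber G).1
  have : Nonempty (Fin (hadwigerNumber G)) := ⟨⟨0, one_le_hadwigerNumber G⟩⟩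
  have hK := (hd _ F ((EReal.coe_lt_coe_iff.1 hlt).le.trans hdF)).trans hF
  refine ⟨SimpleGraph.toSubgraph _ (G.bichromatic_le κ), ?_, IsGraphMinor.le_hadwigerNumber ?_⟩
  · exact (G.isBipartite_bichromatic κ).of_hom ⟨fun x => (x : V), fun h => h⟩
  · exact hK.trans (.of_injective (fun x => ⟨x, trivial⟩) (fun x y h => congrArg Subtype.val h)
      fun x y h => h)

open Filter in
theorem tendsto_two_div_mul_sqrt_log :
    Tendsto (fun t : ℕ => 2 / (t * √(Real.log t))) atTop (nhds 0) := by
  refine Tendsto.const_div_atTop (Tendsto.atTop_mul_atTop₀ tendsto_natCast_atTop_atTop ?_) 2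
  exact Real.tendsto_sqrt_atTop.comp (Real.tendsto_log_atTop.comp tendsto_natCast_atTop_atTop)

theorem mainTheorem2 :
    (∃ c : ℝ, IsKostochkaThomasonConstant c) ∧
    ∀ c : ℝ, IsKostochkaThomasonConstant c →
      ∃ ε : ℕ → ℝ, Filter.Tendsto ε Filter.atTop (nhds 0) ∧
        ∀ t : ℕ, 1 ≤ t →
          ∀ (V : Type*) [Finite V] [Nonempty V] (G : SimpleGraph V),
            (2 * c + ε t) * (t * Real.sqrt (Real.log t)) ≤ (hadwigerNumber G : ℝ) →
              ∃ G' : G.Subgraph, G'.coe.IsBipartite ∧ t ≤ hadwigerNumber G'.coe := by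
  refine ⟨exists_isKostochkaThomasonConstant, ?_⟩
  rintro c ⟨-, ε, hε, hf⟩
  -- The second term adds `2` to the threshold when `t ≥ 2`, which pays for the `-1` in `(h - 1) /
  -- 2` and for strictness. At `t = 1` the logarithm vanishes, and an edgeless subgraph suffices.
  refine ⟨fun t => 2 * ε t + 2 / (t * √(Real.log t)), ?_, fun t ht V _ _ G hG => ?_⟩
  · simpa using (hε.const_mul 2).add tendsto_two_div_mul_sqrt_log
  · rcases ht.eq_or_lt with rfl | ht'
    · have hle : (⊥ : SimpleGraph V) ≤ G := bot_le
      have : Nonempty (SimpleGraph.toSubgraph ⊥ hle).verts := ⟨⟨Classical.arbitrary V, trivial⟩⟩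
      exact ⟨SimpleGraph.toSubgraph ⊥ hle,
        ⟨SimpleGraph.Coloring.mk (fun _ => 0) fun h => absurd h id⟩, one_le_hadwigerNumber _⟩
    · refine exists_isBipartite_of_extremalFunction_lt G
        ((hf t ht).trans_lt (EReal.coe_lt_coe_iff.2 ?_))
      have hX : 0 < t * √(Real.log t) :=
        mul_pos (by positivity) (Real.sqrt_pos.2 (Real.log_pos (by exact_mod_cast ht')))
      have h1 : 2 / (t * √(Real.log t)) * (t * √(Real.log t)) = 2 := div_mul_cancel₀ _ hX.ne'
      nlinarith
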